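/- **Theorem.** Let $\Omega\subset\mathbb R^d$ ($d\ge1$) be a bounded, open, connected $C^1$ domain, and let $\Gamma_D,\Gamma_N$ be disjoint relatively open subsets of $\Gamma=\partial\Omega$ with $\Gamma=\overline{\Gamma_D}\cup\overline{\Gamma_N}$ and $|\overline{\Gamma_D}\cap\overline{\Gamma_N}|=0$ (surface measure $ds$). Let $\alpha,\beta>1$, $\gamma=\alpha\beta$, and write $\tau'=\tau/(\tau-1)$. Assume the following. * $G\in C^1(\mathbb R)$ is convex, non-decreasing and coercive ($G(z)\to\infty$ as $z\to+\infty$), and for some $C>0$ and all sufficiently large $z$: $|z|^\alpha/C-C\le G(z)\le C(|z|^\alpha+1)$, $|G'(z)|\le C(|z|^{\alpha-1}+1)$, $G'(z)z\ge -C$. The coupling $g:[0,\infty)\to\mathbb R$ is the pseudo-inverse of $G'$, i.e. $g(\mu)=\max\{z: G'(z)=\mu\}$ for every $\mu\ge0$ (in particular these maxima exist). * $H\in C^2(\overline\Omega\times\mathbb R^d)$ is bounded below, $p\mapsto H(x,p)$ is strictly convex for every $x\in\Omega$, and for some $C>0$ and all $(x,p)\in\Omega\times\mathbb R^d$: $|p|^\beta/C-C\le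 H\le C(|p|^\beta+1)$, $|D_xH|\le C(|p|^\beta+1)$, $|D_pH|\le C(|p|^{\beta-1}+1)$, $-H+D_pH\cdot p\ge|p|^\beta/C-C$. * $j\in L^{\beta'}(\Gamma_N)$, $j\ge0$, and $\psi\in W^{1,\gamma}(\Omega)$. For a divergence-free field $\Phi\in L^{\gamma'}(\Omega)^d$ the normal trace $\Phi\cdot\nu$ is the functional $\langle\Phi\cdot\nu,v\rangle=\int_\Omega\Phi\cdot Dv\,dx$ of the trace of $v\in W^{1,\gamma}(\Omega)$. It equals $j$ on $\Gamma_N$ if $\langle\Phi\cdot\nu,v\rangle=\int_{\Gamma_N}jv\,ds$ for all $v\in W^{1,\gamma}(\Omega)$ with $v=0$ a.e. on $\Gamma_D$. Then $\langle\Phi\cdot\nu,v\rangle_{\Gamma_D}:=\langle\Phi\cdot\nu,v\rangle-\int_{\Gamma_N}jv\,ds$ depends only on $v|_{\Gamma_D}$ and is the normal trace on $\Gamma_D$. There, $\Phi\cdot\nu\le0$ means $\langle\Phi\cdot\nu,v\rangle_{\Gamma_D}\le0$ for all $v\in W^{1,\gamma}(\Omega)$ with $v\ge0$ a.e. on $\Gamma_D$,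 and, for $w\in W^{1,\gamma}(\Omega)$, $w\,\Phi\cdot\nu=0$ means $\langle\Phi\cdot\nu,\varphi w\rangle_{\Gamma_D}=0$ for all $\varphi\in C^\infty(\overline\Omega)$. A weak solution is a pair $(m,u)\in L^{\alpha'}(\Omega)\times W^{1,\gamma}(\Omega)$ with $m\ge0$, $mD_pH(x,Du)\in L^1(\Omega)^d$, $H(x,Du)=g(m)$ a.e. in $\{m>0\}$, $H(x,Du)\le g(m)$ a.e. in $\Omega$, $-\operatorname{div}(mD_pH(x,Du))=0$ in the sense of distributions, and, in the sense of traces and normal traces, $$mD_pH(x,Du)\cdot\nu=j\ \text{ on }\Gamma_N;\qquad mD_pH(x,Du)\cdot\nu\le0,\quad u\le\psi,\quad(\psi-u)\,mD_pH(x,Du)\cdot\nu=0\ \text{ on }\Gamma_D.$$ Let $(m,u)$ and $(\eta,\xi)$ be two weak solutions. Then: 1. $(\psi-u)\,\eta D_pH(x,D\xi)\cdot\nu=(\psi-\xi)\,mD_pH(x,Du)\cdot\nu=0$ on $\Gamma_D$ in the sense of normal traces. Moreover, if the normal trace of $\eta D_pH(x,D\xi)$ on $\Gamma_D$ is given by a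 locally integrable function $h$ (tested against smooth functions whose support meets $\Gamma$ only inside $\Gamma_D$), then $(\psi-u)h=0$ at almost every point of $\Gamma_D$; likewise for $mD_pH(x,Du)$ and $\psi-\xi$. 2. $\eta=m$ a.e. in $\Omega$. 3. $Du=D\xi$ a.e. in $\{x\in\Omega: m(x)>0\}$. -/

import Mathlib

open MeasureTheory Set Filter Topology
open scoped ContDiff RealInnerProductSpace

noncomputable section

namespace MixedMFG

/-- The Euclidean space `ℝ^d`. -/
abbrev Eu (d : ℕ) : Type := EuclideanSpace ℝ (Fin d)

variable {d : ℕ}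

/-! ### The domain and its boundary -/

/-- `Ω` has a `C¹` boundary: near each boundary point, `Ω` is the strict subgraph, in some unit
direction `e`, of a `C¹` function defined on the hyperplane orthogonal to `e`. -/
def HasC1Boundary (Ω : Set (Eu d)) : Prop :=
  ∀ x₀ ∈ frontier Ω, ∃ e : Eu d, ‖e‖ = 1 ∧ ∃ h : ((ℝ ∙ e)ᗮ : Submodule ℝ (Eu d)) → ℝ,
    ContDiff ℝ 1 h ∧ ∃ r > 0, ∀ y ∈ Metric.ball x₀ r,
      (y ∈ Ω ↔ ⟪e, y⟫ < h ((ℝ ∙ e)ᗮ.orthogonalProjectionOnto y))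

/-- A bounded, open, connected (in particular nonempty) `C¹` domain of `ℝ^d`. -/
structure IsC1Domain (Ω : Set (Eu d)) : Prop where
  isOpen : IsOpen Ω
  isConnected : IsConnected Ω
  isBounded : Bornology.IsBounded Ω
  c1 : HasC1Boundary Ω

/-- The surface measure of `∂Ω`: the `(d-1)`-dimensional Hausdorff measure, normalised as usual so
that it is Lebesgue measure on hyperplanes, restricted to `∂Ω`. -/
def surf (Ω : Set (Eu d)) : Measure (Eu d) :=
  (Measure.euclideanHausdorffMeasure (d - 1) : Measure (Eu d)).restrict (frontier Ω)

/-- `ΓD` and `ΓN` are disjoint relatively open subsets of `∂Ω` whose closures cover `∂Ω` and meet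
in a set of surface measure zero. -/
structure IsBoundaryPartition (Ω ΓD ΓN : Set (Eu d)) : Prop where
  open_D : ∃ U, IsOpen U ∧ ΓD = U ∩ frontier Ω
  open_N : ∃ U, IsOpen U ∧ ΓN = U ∩ frontier Ω
  disjoint : Disjoint ΓD ΓN
  cover : closure ΓD ∪ closure ΓN = frontier Ω
  null_interface : surf Ω (closure ΓD ∩ closure ΓN) = 0

/-! ### Sobolev functions, traces, weak divergence, normal traces -/

/-- `v ∈ W^{1,q}(Ω)` with weak gradient `Dv`. -/
structure MemSobolev (Ω : Set (Eu d)) (q : ℝ) (v : Eu d → ℝ) (Dv : Eu d → Eu d) : Prop where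
  memLp : MemLp v (ENNReal.ofReal q) (volume.restrict Ω)
  memLp_grad : MemLp Dv (ENNReal.ofReal q) (volume.restrict Ω)
  weak_grad : ∀ φ : Eu d → ℝ, ContDiff ℝ ∞ φ → HasCompactSupport φ → tsupport φ ⊆ Ω →
    ∫ x in Ω, v x • gradient φ x = - ∫ x in Ω, φ x • Dv x

/-- `t ∈ L^q(∂Ω)` is the trace on `∂Ω` of the Sobolev function `v` (with weak gradient `Dv`): there
are functions `f n`, smooth up to the boundary, with `f n → v` in `W^{1,q}(Ω)` and
`f n → t` in `L^q(∂Ω)`. -/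
structure HasTrace (Ω : Set (Eu d)) (q : ℝ) (v : Eu d → ℝ) (Dv : Eu d → Eu d)
    (t : Eu d → ℝ) : Prop where
  memLp : MemLp t (ENNReal.ofReal q) (surf Ω)
  approx : ∃ f : ℕ → Eu d → ℝ, (∀ n, ContDiff ℝ ∞ (f n)) ∧
    Tendsto (fun n => eLpNorm (fun x => f n x - v x) (ENNReal.ofReal q) (volume.restrict Ω))
      atTop (𝓝 0) ∧
    Tendsto (fun n => eLpNorm (fun x => gradient (f n) x - Dv x) (ENNReal.ofReal q)
      (volume.restrict Ω)) atTop (𝓝 0) ∧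
    Tendsto (fun n => eLpNorm (fun x => f n x - t x) (ENNReal.ofReal q) (surf Ω)) atTop (𝓝 0)

/-- `f ∈ L¹(Ω)` is the distributional divergence in `Ω` of the vector field `Φ ∈ L¹(Ω)`. -/
structure IsWeakDiv (Ω : Set (Eu d)) (Φ : Eu d → Eu d) (f : Eu d → ℝ) : Prop where
  integrable : IntegrableOn Φ Ω
  integrable_div : IntegrableOn f Ω
  eq : ∀ φ : Eu d → ℝ, ContDiff ℝ ∞ φ → HasCompactSupport φ → tsupport φ ⊆ Ω →
    ∫ x in Ω, f x * φ x = - ∫ x in Ω, ⟪Φ x, gradient φ x⟫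

/-- The normal trace `Φ · ν` on `∂Ω` of a vector field `Φ ∈ L^{q'}(Ω)` with weak divergence
`f ∈ L^{q'}(Ω)`: the bounded functional which takes (the trace of) `v ∈ W^{1,q}(Ω)` to
`∫_Ω Φ · Dv + v f dx`. By the divergence theorem this is `∫_{∂Ω} v Φ · ν ds` for smooth `Φ`. -/
def normalTrace (Ω : Set (Eu d)) (Φ : Eu d → Eu d) (f : Eu d → ℝ)
    (v : Eu d → ℝ) (Dv : Eu d → Eu d) : ℝ :=
  ∫ x in Ω, (⟪Φ x, Dv x⟫ + v x * f x)

/-- The part on `Γ_D` of the normal trace of a divergence-free field `Φ` with `Φ · ν = j` on `Γ_N`: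
the functional "`∫_{Γ_D} v Φ · ν ds`", that is, the normal trace of `Φ` minus `∫_{Γ_N} j v ds`.
Here `t` is the trace of `v`. When `Φ · ν = j` on `Γ_N`, the value depends only on the restriction
of `t` to `Γ_D`. -/
def dirichletFlux (Ω ΓN : Set (Eu d)) (j : Eu d → ℝ) (Φ : Eu d → Eu d)
    (v : Eu d → ℝ) (Dv : Eu d → Eu d) (t : Eu d → ℝ) : ℝ :=
  normalTrace Ω Φ 0 v Dv - ∫ x in ΓN, j x * t x ∂(surf Ω)

/-- `w Φ · ν = 0` on `Γ_D` in the sense of normal traces, for a Sobolev function `w` with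
weak gradient `Dw` and trace `t`: for every `φ` smooth up to the boundary,
"`∫_{Γ_D} φ w Φ · ν ds = 0`". -/
def FluxProductVanishes (Ω ΓN : Set (Eu d)) (j : Eu d → ℝ) (Φ : Eu d → Eu d)
    (w : Eu d → ℝ) (Dw : Eu d → Eu d) (t : Eu d → ℝ) : Prop :=
  ∀ φ : Eu d → ℝ, ContDiff ℝ ∞ φ →
    dirichletFlux Ω ΓN j Φ (fun x => φ x * w x) (fun x => φ x • Dw x + w x • gradient φ x)
      (fun x => φ x * t x) = 0

/-- On `Γ_D` the normal trace of `Φ` is the (locally integrable) function `h`: the two agree on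
smooth functions whose support meets `∂Ω` only inside `Γ_D`. -/
def FluxIsFunction (Ω ΓD ΓN : Set (Eu d)) (j : Eu d → ℝ) (Φ : Eu d → Eu d)
    (h : Eu d → ℝ) : Prop :=
  ∀ φ : Eu d → ℝ, ContDiff ℝ ∞ φ → HasCompactSupport φ → tsupport φ ∩ frontier Ω ⊆ ΓD →
    IntegrableOn (fun x => h x * φ x) ΓD (surf Ω) ∧
    dirichletFlux Ω ΓN j Φ φ (gradient φ) φ = ∫ x in ΓD, h x * φ x ∂(surf Ω)

/-! ### The data -/

/-- Assumptions on the potential `G : ℝ → ℝ` of the coupling, with exponent `α > 1`. -/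
structure IsPotential (G : ℝ → ℝ) (α : ℝ) : Prop where
  c1 : ContDiff ℝ 1 G
  coercive : Tendsto G atTop atTop
  convex : ConvexOn ℝ univ G
  monotone : Monotone G
  one_lt : 1 < α
  growth : ∃ C > 0, ∀ᶠ z in atTop, |z| ^ α / C - C ≤ G z ∧ G z ≤ C * (|z| ^ α + 1) ∧
    |deriv G z| ≤ C * (|z| ^ (α - 1) + 1)
  lower : ∃ C > 0, ∀ᶠ z in atTop, - C ≤ deriv G z * z

/-- `g : [0,∞) → ℝ` is the pseudo-inverse of `G'`: `g μ = max {z | G' z = μ}` for all `μ ≥ 0`. -/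
def IsPseudoInverse (g G : ℝ → ℝ) : Prop :=
  ∀ μ : ℝ, 0 ≤ μ → IsGreatest {z : ℝ | deriv G z = μ} (g μ)

/-- Assumptions on the Hamiltonian `H : Ω̄ × ℝ^d → ℝ`, with exponent `β > 1`. The gradient of
`H x` at `p` is `D_p H(x,p)`, and the gradient of `fun y => H y p` at `x` is `D_x H(x,p)`. -/
structure IsHamiltonian (Ω : Set (Eu d)) (H : Eu d → Eu d → ℝ) (β : ℝ) : Prop where
  c2 : ContDiffOn ℝ 2 (fun z : Eu d × Eu d => H z.1 z.2) (closure Ω ×ˢ univ)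
  bddBelow : ∃ c : ℝ, ∀ x ∈ closure Ω, ∀ p, c ≤ H x p
  convex : ∀ x ∈ Ω, StrictConvexOn ℝ univ (H x)
  one_lt : 1 < β
  growth : ∃ C > 0, ∀ x ∈ Ω, ∀ p : Eu d,
    ‖p‖ ^ β / C - C ≤ H x p ∧ H x p ≤ C * (‖p‖ ^ β + 1) ∧
    ‖gradient (fun y => H y p) x‖ ≤ C * (‖p‖ ^ β + 1) ∧
    ‖gradient (H x) p‖ ≤ C * (‖p‖ ^ (β - 1) + 1)
  lower : ∃ C > 0, ∀ x ∈ Ω, ∀ p : Eu d,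
    ‖p‖ ^ β / C - C ≤ - H x p + ⟪gradient (H x) p, p⟫

/-- Assumptions on the incoming flow: `j ∈ L^{β'}(Γ_N)` and `j ≥ 0`. -/
structure IsInflow (Ω ΓN : Set (Eu d)) (j : Eu d → ℝ) (β : ℝ) : Prop where
  memLp : MemLp j (ENNReal.ofReal (Real.conjExponent β)) ((surf Ω).restrict ΓN)
  nonneg : ∀ᵐ x ∂(surf Ω).restrict ΓN, 0 ≤ j x

/-! ### Weak solutions -/

/-- The flow `m D_p H(x, Du)`. -/
def flow (H : Eu d → Eu d → ℝ) (m : Eu d → ℝ) (Du : Eu d → Eu d) (x : Eu d) : Eu d :=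
  m x • gradient (H x) (Du x)

/-- `(m, u) ∈ L^{α'}(Ω) × W^{1,γ}(Ω)`, `γ = α β`, is a weak solution of the mean-field game with
mixed boundary conditions. Here `Du` is the weak gradient of `u`, and `tu` its trace;
`Dψ` and `tψ` are those of the exit cost `ψ`. -/
structure IsWeakSolution (Ω ΓD ΓN : Set (Eu d)) (α β : ℝ) (H : Eu d → Eu d → ℝ) (g : ℝ → ℝ)
    (j : Eu d → ℝ) (ψ : Eu d → ℝ) (Dψ : Eu d → Eu d) (tψ : Eu d → ℝ)
    (m u : Eu d → ℝ) (Du : Eu d → Eu d) (tu : Eu d → ℝ) : Prop where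
  memLp_m : MemLp m (ENNReal.ofReal (Real.conjExponent α)) (volume.restrict Ω)
  sobolev_u : MemSobolev Ω (α * β) u Du
  trace_u : HasTrace Ω (α * β) u Du tu
  /-- `m ≥ 0` and `m D_p H(x, Du) ∈ L¹(Ω)`. -/
  nonneg : ∀ᵐ x ∂volume.restrict Ω, 0 ≤ m x
  flow_integrable : IntegrableOn (flow H m Du) Ω
  /-- The Hamilton-Jacobi equation. -/
  hj_eq : ∀ᵐ x ∂volume.restrict Ω, 0 < m x → H x (Du x) = g (m x)
  hj_le : ∀ᵐ x ∂volume.restrict Ω, H x (Du x) ≤ g (m x)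
  /-- `-div (m D_p H(x, Du)) = 0` in the sense of distributions. -/
  transport : IsWeakDiv Ω (flow H m Du) 0
  /-- `m D_p H(x, Du) · ν = j` on `Γ_N`: the normal trace is `j` on functions vanishing on `Γ_D`. -/
  neumann : ∀ v Dv t, MemSobolev Ω (α * β) v Dv → HasTrace Ω (α * β) v Dv t →
    (∀ᵐ x ∂(surf Ω).restrict ΓD, t x = 0) →
      normalTrace Ω (flow H m Du) 0 v Dv = ∫ x in ΓN, j x * t x ∂(surf Ω)
  /-- `m D_p H(x, Du) · ν ≤ 0` on `Γ_D`. -/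
  exit : ∀ v Dv t, MemSobolev Ω (α * β) v Dv → HasTrace Ω (α * β) v Dv t →
    (∀ᵐ x ∂(surf Ω).restrict ΓD, 0 ≤ t x) →
      dirichletFlux Ω ΓN j (flow H m Du) v Dv t ≤ 0
  /-- `u ≤ ψ` on `Γ_D`. -/
  le_exit_cost : ∀ᵐ x ∂(surf Ω).restrict ΓD, tu x ≤ tψ x
  /-- `(ψ - u) m D_p H(x, Du) · ν = 0` on `Γ_D`. -/
  contact : FluxProductVanishes Ω ΓN j (flow H m Du)
    (fun x => ψ x - u x) (fun x => Dψ x - Du x) (fun x => tψ x - tu x)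

end MixedMFG

end

open MixedMFG

open MeasureTheory Set Filter Topology
open scoped ContDiff RealInnerProductSpace

noncomputable section

namespace MixedMFG

variable {d : ℕ}

/-! ### Convergence in `L^p` -/

/-! This is the Lasry–Lions monotonicity argument, with the exit condition on `ΓD` treated as a
variational inequality. Put `Φ = m D_pH(x, Du)` and `Ψ = η D_pH(x, Dξ)`, and let `F_Φ`, `F_Ψ` be
their fluxes through `ΓD`. Testing `Φ` with `u - ξ` and `Ψ` with `ξ - u`, the terms on `ΓN` cancel.
Inserting `ψ` and using the contact conditions `F_Φ(ψ - u) = F_Ψ(ψ - ξ) = 0` gives `∫ Φ·(Du - Dξ) +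
Ψ·(Dξ - Du) = F_Φ(ψ - ξ) + F_Ψ(ψ - u)`. The right side is at most zero by the exit sign condition.
The integrand on the left is nonnegative by convexity of `H` and strict monotonicity of `g`
(`monotonicity`). So both fluxes vanish and the integrand is zero a.e.; its equality case yields (2)
and (3).

For (1), a nonpositive functional that vanishes at `w ≥ 0` vanishes at everything dominated by a
multiple of `w` (`IsOutgoing.dirichletFlux_eq_zero`), in particular at `φ w` with `φ` smooth. The
pointwise version (`IsOutgoing.ae_mul_eq_zero`) uses `φ arctan w` instead: a bounded factor can be
integrated against a density `h` that is only locally integrable.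

The duality pairings make sense because the flow lies in `L^{γ'}` (`memLp_flow`), and traces, being
limits of smooth functions, are handled by approximation. -/

theorem integrable_inner_of_memLp {X E : Type*} [MeasurableSpace X] {μ : Measure X}
    [NormedAddCommGroup E] [InnerProductSpace ℝ E] {p p' : ENNReal} [ENNReal.HolderConjugate p' p]
    {Φ F : X → E} (hΦ : MemLp Φ p' μ) (hF : MemLp F p μ) :
    Integrable (fun x => ⟪Φ x, F x⟫) μ :=
  memLp_one_iff_integrable.1 <| hΦ.of_bilin (fun x y => ⟪x, y⟫) 1 hF
    (hΦ.aestronglyMeasurable.inner hF.aestronglyMeasurable)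
    (.of_forall fun x => by simpa using nnnorm_inner_le_nnnorm (𝕜 := ℝ) (Φ x) (F x))

theorem tendsto_integral_inner {X E : Type*} [MeasurableSpace X] {μ : Measure X}
    [NormedAddCommGroup E] [InnerProductSpace ℝ E] {p p' : ENNReal} [ENNReal.HolderConjugate p' p]
    {Φ : X → E} {F : ℕ → X → E} {F₀ : X → E} (hΦ : MemLp Φ p' μ) (hF : ∀ n, MemLp (F n) p μ)
    (hF₀ : MemLp F₀ p μ)
    (h : Tendsto (fun n => eLpNorm (fun x => F n x - F₀ x) p μ) atTop (𝓝 0)) :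
    Tendsto (fun n => ∫ x, ⟪Φ x, F n x⟫ ∂μ) atTop (𝓝 (∫ x, ⟪Φ x, F₀ x⟫ ∂μ)) := by
  refine tendsto_integral_of_L1' _ (integrable_inner_of_memLp hΦ hF₀).aestronglyMeasurable
    (.of_forall fun n => integrable_inner_of_memLp hΦ (hF n)) ?_
  have h2 := ENNReal.Tendsto.const_mul (a := eLpNorm Φ p' μ) h (.inr hΦ.eLpNorm_ne_top)
  rw [mul_zero] at h2
  refine tendsto_of_tendsto_of_tendsto_of_le_of_le tendsto_const_nhds h2 (fun _ => zero_le)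
    fun n => ?_
  have := eLpNorm_le_eLpNorm_mul_eLpNorm'_of_norm (p := p') (q := p) (r := 1)
    hΦ.aestronglyMeasurable ((hF n).sub hF₀).aestronglyMeasurable (fun x y => ⟪x, y⟫) 1
    (.of_forall fun x => by simpa using norm_inner_le_norm (𝕜 := ℝ) (Φ x) ((F n - F₀) x))
  simpa [inner_sub_right, Pi.sub_def] using this

/-- Needed for the chain rule, where a bounded coefficient converging only a.e. multiplies a fixed
`L^p` gradient. -/
theorem tendsto_eLpNorm_of_dominated {X E : Type*} [MeasurableSpace X] {μ : Measure X}
    [NormedAddCommGroup E] {p : ENNReal} (hp₀ : p ≠ 0) (hp : p ≠ ⊤) {F : ℕ → X → E} {b : X → ℝ}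
    (hF : ∀ n, AEStronglyMeasurable (F n) μ) (hb : MemLp b p μ)
    (hFb : ∀ n, ∀ᵐ x ∂μ, ‖F n x‖ ≤ b x)
    (h : ∀ᵐ x ∂μ, Tendsto (fun n => F n x) atTop (𝓝 0)) :
    Tendsto (fun n => eLpNorm (F n) p μ) atTop (𝓝 0) := by
  have hpos := ENNReal.toReal_pos hp₀ hp
  simp only [eLpNorm_eq_lintegral_rpow_enorm_toReal hp₀ hp]
  have key : Tendsto (fun n => ∫⁻ x, ‖F n x‖ₑ ^ p.toReal ∂μ) atTop (𝓝 (∫⁻ _, 0 ∂μ)) := by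
    refine tendsto_lintegral_of_dominated_convergence' (fun x => ‖b x‖ₑ ^ p.toReal)
      (fun n => (hF n).enorm.pow_const _) (fun n => ?_)
      (lintegral_rpow_enorm_lt_top_of_eLpNorm_lt_top hp₀ hp hb.2).ne ?_
    · filter_upwards [hFb n] with x hx
      refine ENNReal.rpow_le_rpow (enorm_le_iff_norm_le.2 (hx.trans (le_abs_self _))) hpos.le
    · filter_upwards [h] with x hx
      have := (hx.enorm).ennrpow_const p.toReal
      simpa [hpos] using this
  have := key.ennrpow_const (1 / p.toReal)
  simpa [hpos] using this

theorem memLp_of_continuous {E : Type*} [NormedAddCommGroup E] {μ : Measure (Eu d)}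
    [IsFiniteMeasure μ] {s : Set (Eu d)} (hs : Bornology.IsBounded s) (hμ : ∀ᵐ x ∂μ, x ∈ s)
    {f : Eu d → E} (hf : Continuous f) (p : ENNReal) : MemLp f p μ := by
  obtain ⟨C, hC⟩ := hs.isCompact_closure.exists_bound_of_continuousOn hf.continuousOn
  exact .of_bound hf.aestronglyMeasurable C (hμ.mono fun x hx => hC x (subset_closure hx))

theorem tendsto_eLpNorm_of_le_mul {X E F : Type*} [MeasurableSpace X] {μ : Measure X}
    [NormedAddCommGroup E] [NormedAddCommGroup F] {p : ENNReal} {f : ℕ → X → E} {g : ℕ → X → F}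
    {C : ℝ} (hfg : ∀ n, ∀ᵐ x ∂μ, ‖f n x‖ ≤ C * ‖g n x‖)
    (hg : Tendsto (fun n => eLpNorm (g n) p μ) atTop (𝓝 0)) :
    Tendsto (fun n => eLpNorm (f n) p μ) atTop (𝓝 0) := by
  have h2 := ENNReal.Tendsto.const_mul (a := ENNReal.ofReal C) hg (.inr ENNReal.ofReal_ne_top)
  rw [mul_zero] at h2
  exact tendsto_of_tendsto_of_tendsto_of_le_of_le tendsto_const_nhds h2 (fun _ => zero_le)
    fun n => eLpNorm_le_mul_eLpNorm_of_ae_le_mul (hfg n) p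

theorem tendsto_eLpNorm_add {X E : Type*} [MeasurableSpace X] {μ : Measure X}
    [NormedAddCommGroup E] {p : ENNReal} (hp : 1 ≤ p) {f g : ℕ → X → E}
    (hf : ∀ n, AEStronglyMeasurable (f n) μ) (hg : ∀ n, AEStronglyMeasurable (g n) μ)
    (hf₀ : Tendsto (fun n => eLpNorm (f n) p μ) atTop (𝓝 0))
    (hg₀ : Tendsto (fun n => eLpNorm (g n) p μ) atTop (𝓝 0)) :
    Tendsto (fun n => eLpNorm (fun x => f n x + g n x) p μ) atTop (𝓝 0) := by
  have h2 := hf₀.add hg₀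
  rw [add_zero] at h2
  exact tendsto_of_tendsto_of_tendsto_of_le_of_le tendsto_const_nhds h2 (fun _ => zero_le)
    fun n => eLpNorm_add_le (hf n) (hg n) hp

/-! ### The surface measure is finite -/

theorem euclideanHausdorffMeasure_image_lt_top {X Y : Type*} [EMetricSpace X]
    [EMetricSpace Y] [MeasurableSpace X] [BorelSpace X] [MeasurableSpace Y] [BorelSpace Y]
    {K : NNReal} {f : X → Y} {s : Set X} (hf : LipschitzOnWith K f s) (k : ℕ)
    (hs : Measure.euclideanHausdorffMeasure k s < ⊤) :
    Measure.euclideanHausdorffMeasure k (f '' s) < ⊤ := by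
  rw [Measure.euclideanHausdorffMeasure_def] at hs ⊢
  rw [Measure.smul_apply, ENNReal.smul_def, smul_eq_mul] at hs ⊢
  calc _ ≤ _ * ((K : ENNReal) ^ (k : ℝ) * μH[k] s) := by
        gcongr; exact hf.hausdorffMeasure_image_le (by positivity)
    _ = (K : ENNReal) ^ (k : ℝ) * (_ * μH[k] s) := by ring
    _ < ⊤ := ENNReal.mul_lt_top (ENNReal.rpow_lt_top_of_nonneg (by positivity) (by simp)) hs

/-- The boundary is compact, and near each of its points it lies in the Lipschitz image of a bounded
piece of a hyperplane. Finiteness is what makes smooth functions lie in every `L^p(∂Ω)`. -/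
theorem isFiniteMeasure_surf (hd : 1 ≤ d) {Ω : Set (Eu d)} (hΩ : IsC1Domain Ω) :
    IsFiniteMeasure (surf Ω) := by
  obtain ⟨k, rfl⟩ : ∃ k, d = k + 1 := ⟨d - 1, by omega⟩
  have hK : IsCompact (frontier Ω) :=
    hΩ.isBounded.isCompact_closure.of_isClosed_subset isClosed_frontier frontier_subset_closure
  refine ⟨?_⟩
  rw [surf, Measure.restrict_apply_univ, Nat.add_sub_cancel]
  refine hK.measure_lt_top_of_nhdsWithin fun x₀ hx₀ => ?_
  obtain ⟨e, he, h, hh, r, hr, hball⟩ := hΩ.c1 x₀ hx₀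
  have : Fact (Module.finrank ℝ (Eu (k + 1)) = k + 1) := ⟨by simp⟩
  have hfin : Module.finrank ℝ (ℝ ∙ e)ᗮ = k :=
    Submodule.finrank_orthogonal_span_singleton (norm_ne_zero_iff.1 (by simp [he]))
  set P := (ℝ ∙ e)ᗮ.orthogonalProjectionOnto
  have hgc : ContDiff ℝ 1 (fun z : (ℝ ∙ e)ᗮ => (z : Eu (k + 1)) + h z • e) :=
    (ℝ ∙ e)ᗮ.subtypeL.contDiff.add (hh.fun_smul contDiff_const)
  obtain ⟨K, t, ht, hLip⟩ := (hgc.contDiffAt (x := P x₀)).exists_lipschitzOnWith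
  set s := t ∩ Metric.ball (P x₀) 1
  -- The hyperplane has dimension exactly `k = d - 1`, so there this Hausdorff measure is Lebesgue
  -- measure, finite on the unit ball.
  have hs : Measure.euclideanHausdorffMeasure k s < ⊤ := by
    have hvol := InnerProductSpace.euclideanHausdorffMeasure_eq_volume (V := (ℝ ∙ e)ᗮ)
    rw [hfin] at hvol
    rw [hvol]
    exact (measure_mono inter_subset_right).trans_lt measure_ball_lt_top
  refine ⟨(fun z : (ℝ ∙ e)ᗮ => (z : Eu (k + 1)) + h z • e) '' s, ?_,
    euclideanHausdorffMeasure_image_lt_top (hLip.mono inter_subset_left) k hs⟩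
  have hs' : s ∈ 𝓝 (P x₀) := inter_mem ht (Metric.ball_mem_nhds _ one_pos)
  filter_upwards [mem_nhdsWithin_of_mem_nhds (Metric.ball_mem_nhds x₀ hr), self_mem_nhdsWithin,
    mem_nhdsWithin_of_mem_nhds (P.continuous.continuousAt.preimage_mem_nhds hs')] with y hyb hyf hys
  refine ⟨P y, hys, ?_⟩
  -- A boundary point is on the graph: it is not in the open set `Ω`, hence not strictly below; were
  -- it strictly above, a whole neighbourhood would miss `Ω`.
  have hle : h (P y) ≤ ⟪e, y⟫ := by
    by_contra! hlt
    have hyΩ := (hball y hyb).2 hlt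
    rw [hΩ.isOpen.frontier_eq] at hyf
    exact hyf.2 hyΩ
  have hge : ⟪e, y⟫ ≤ h (P y) := by
    by_contra! hlt
    have hopen : ∀ᶠ z in 𝓝 y, h (P z) < ⟪e, z⟫ :=
      (hh.continuous.comp P.continuous).continuousAt.eventually_lt
        (continuous_const.inner continuous_id).continuousAt hlt
    have hn : ∀ᶠ z in 𝓝 y, z ∉ Ω := by
      filter_upwards [hopen, Metric.isOpen_ball.mem_nhds hyb] with z hz hzb hzΩ
      exact absurd ((hball z hzb).1 hzΩ) (not_lt.2 hz.le)
    exact (mem_closure_iff_frequently.1 hyf.1) hn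
  have hdec := Submodule.starProjection_add_starProjection_orthogonal (K := ℝ ∙ e) y
  rw [Submodule.starProjection_unit_singleton ℝ he] at hdec
  change (P y : Eu (k + 1)) + h (P y) • e = y
  rw [← le_antisymm hge hle]
  exact (add_comm _ _).trans hdec

/-! ### Gradients of smooth functions -/

theorem continuous_gradient {f : Eu d → ℝ} (hf : ContDiff ℝ ∞ f) :
    Continuous (gradient f) :=
  (InnerProductSpace.toDual ℝ (Eu d)).symm.continuous.comp (hf.continuous_fderiv (by simp))

theorem gradient_mul {f g : Eu d → ℝ} {x : Eu d} (hf : DifferentiableAt ℝ f x)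
    (hg : DifferentiableAt ℝ g x) :
    gradient (fun y => f y * g y) x = f x • gradient g x + g x • gradient f x := by
  refine ext_inner_right ℝ fun v => ?_
  simp [inner_add_left, inner_smul_left, fderiv_fun_mul hf hg]

theorem gradient_arctan {f : Eu d → ℝ} {x : Eu d} (hf : DifferentiableAt ℝ f x) :
    gradient (fun y => Real.arctan (f y)) x = (1 / (1 + f x ^ 2)) • gradient f x := by
  refine ext_inner_right ℝ fun v => ?_
  simp [inner_smul_left, fderiv_arctan hf]

theorem gradient_eq_zero_of_notMem_tsupport {φ : Eu d → ℝ} {x : Eu d} (hx : x ∉ tsupport φ) :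
    gradient φ x = 0 := by
  have : φ =ᶠ[𝓝 x] 0 := notMem_tsupport_iff_eventuallyEq.1 hx
  simp [gradient, this.fderiv_eq]

theorem integral_smul_gradient {f φ : Eu d → ℝ} (hf : ContDiff ℝ ∞ f) (hφ : ContDiff ℝ ∞ φ)
    (hφc : HasCompactSupport φ) : ∫ x, f x • gradient φ x = - ∫ x, φ x • gradient f x := by
  have hg : HasCompactSupport (gradient φ) := 
    hφc.mono' fun x hx => by_contra fun h => hx (gradient_eq_zero_of_notMem_tsupport h)
  have i1 : Integrable (fun x => f x • gradient φ x) :=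
    (hf.continuous.smul (continuous_gradient hφ)).integrable_of_hasCompactSupport hg.smul_left
  have i2 : Integrable (fun x => φ x • gradient f x) :=
    (hφ.continuous.smul (continuous_gradient hf)).integrable_of_hasCompactSupport hφc.smul_right
  have i3 : Integrable (fun x => f x * φ x) :=
    (hf.continuous.mul hφ.continuous).integrable_of_hasCompactSupport hφc.mul_left
  refine ext_inner_left ℝ fun v => ?_
  rw [inner_neg_right, ← integral_inner (𝕜 := ℝ) i1, ← integral_inner (𝕜 := ℝ) i2]
  have e1 := i1.const_inner (𝕜 := ℝ) v
  have e2 := i2.const_inner (𝕜 := ℝ) v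
  simp only [inner_smul_right, inner_gradient_right, conj_trivial] at e1 e2 ⊢
  simp only [mul_comm (φ _)] at e2 ⊢
  exact integral_mul_fderiv_eq_neg_fderiv_mul_of_integrable e2 e1 i3
    (fun x _ => hf.differentiable (by simp) x) (fun x _ => hφ.differentiable (by simp) x)

/-! ### Sobolev functions with traces -/

/-- The smooth functions `f n` converge to `v` in `W^{1,q}(Ω)`, and their boundary values to `t`
in `L^q(∂Ω)`. -/
structure TraceApprox (Ω : Set (Eu d)) (q : ℝ) (v : Eu d → ℝ) (Dv : Eu d → Eu d)
    (t : Eu d → ℝ) (f : ℕ → Eu d → ℝ) : Prop where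
  smooth : ∀ n, ContDiff ℝ ∞ (f n)
  tendsto : Tendsto (fun n => eLpNorm (fun x => f n x - v x) (ENNReal.ofReal q)
    (volume.restrict Ω)) atTop (𝓝 0)
  tendsto_grad : Tendsto (fun n => eLpNorm (fun x => gradient (f n) x - Dv x) (ENNReal.ofReal q)
    (volume.restrict Ω)) atTop (𝓝 0)
  tendsto_trace : Tendsto (fun n => eLpNorm (fun x => f n x - t x) (ENNReal.ofReal q) (surf Ω))
    atTop (𝓝 0)

/-- `v ∈ W^{1,q}(Ω)` with weak gradient `Dv` and trace `t`. -/
structure TracedSobolev (Ω : Set (Eu d)) (q : ℝ) (v : Eu d → ℝ) (Dv : Eu d → Eu d)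
    (t : Eu d → ℝ) : Prop where
  sobolev : MemSobolev Ω q v Dv
  trace : HasTrace Ω q v Dv t

theorem TracedSobolev.exists_approx {Ω : Set (Eu d)} {q : ℝ} {v : Eu d → ℝ} {Dv : Eu d → Eu d}
    {t : Eu d → ℝ} (h : TracedSobolev Ω q v Dv t) : ∃ f, TraceApprox Ω q v Dv t f :=
  let ⟨f, h1, h2, h3, h4⟩ := h.trace.approx
  ⟨f, h1, h2, h3, h4⟩

theorem TraceApprox.comp {Ω : Set (Eu d)} {q : ℝ} {v : Eu d → ℝ} {Dv : Eu d → Eu d}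
    {t : Eu d → ℝ} {f : ℕ → Eu d → ℝ} (h : TraceApprox Ω q v Dv t f) {k : ℕ → ℕ}
    (hk : Tendsto k atTop atTop) : TraceApprox Ω q v Dv t (fun n => f (k n)) :=
  ⟨fun _ => h.smooth _, h.tendsto.comp hk, h.tendsto_grad.comp hk, h.tendsto_trace.comp hk⟩

/-- A bounded open set whose boundary has finite surface measure. -/
structure IsAdmissible (Ω : Set (Eu d)) : Prop where
  isOpen : IsOpen Ω
  isBounded : Bornology.IsBounded Ω
  finite_surf : IsFiniteMeasure (surf Ω)

theorem IsC1Domain.isAdmissible (hd : 1 ≤ d) {Ω : Set (Eu d)} (hΩ : IsC1Domain Ω) :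
    IsAdmissible Ω :=
  ⟨hΩ.isOpen, hΩ.isBounded, isFiniteMeasure_surf hd hΩ⟩

section Domain

variable {Ω : Set (Eu d)} {q : ℝ}

theorem IsAdmissible.finite_volume (hΩ : IsAdmissible Ω) : IsFiniteMeasure (volume.restrict Ω) :=
  ⟨by simpa using hΩ.isBounded.measure_lt_top⟩

theorem IsAdmissible.memLp_interior (hΩ : IsAdmissible Ω) {E : Type*} [NormedAddCommGroup E]
    {f : Eu d → E} (hf : Continuous f) (p : ENNReal) : MemLp f p (volume.restrict Ω) :=
  have := hΩ.finite_volume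
  memLp_of_continuous hΩ.isBounded (ae_restrict_mem hΩ.isOpen.measurableSet) hf p

theorem ae_surf_mem : ∀ᵐ x ∂surf Ω, x ∈ closure Ω :=
  (ae_restrict_mem isClosed_frontier.measurableSet).mono fun _ hx => frontier_subset_closure hx

theorem IsAdmissible.memLp_surf (hΩ : IsAdmissible Ω) {E : Type*} [NormedAddCommGroup E]
    {f : Eu d → E} (hf : Continuous f) (p : ENNReal) : MemLp f p (surf Ω) :=
  have := hΩ.finite_surf
  memLp_of_continuous hΩ.isBounded.closure ae_surf_mem hf p

theorem IsAdmissible.exists_bound (hΩ : IsAdmissible Ω) {E : Type*} [NormedAddCommGroup E]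
    {f : Eu d → E} (hf : Continuous f) :
    ∃ C, 0 ≤ C ∧ (∀ x ∈ closure Ω, ‖f x‖ ≤ C) ∧ (∀ᵐ x ∂volume.restrict Ω, ‖f x‖ ≤ C) ∧
      ∀ᵐ x ∂surf Ω, ‖f x‖ ≤ C := by
  obtain ⟨C, hC⟩ := hΩ.isBounded.isCompact_closure.exists_bound_of_continuousOn hf.continuousOn
  have h : ∀ x ∈ closure Ω, ‖f x‖ ≤ max C 0 := fun x hx => (hC x hx).trans (le_max_left _ _)
  exact ⟨max C 0, le_max_right _ _, h,
    (ae_restrict_mem hΩ.isOpen.measurableSet).mono fun x hx => h x (subset_closure hx),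
    ae_surf_mem.mono h⟩

theorem holderConjugate (hq : 1 < q) :
    ENNReal.HolderConjugate (ENNReal.ofReal (Real.conjExponent q)) (ENNReal.ofReal q) :=
  (Real.HolderConjugate.conjExponent hq).symm.ennrealOfReal

/-- Integration by parts holds for each smooth `f n` and both sides pass to the limit by Hölder, so
the weak gradient comes for free. Every operation below then only needs an approximating sequence.
-/
theorem TraceApprox.tracedSobolev (hΩ : IsAdmissible Ω) (hq : 1 < q) {v : Eu d → ℝ}
    {Dv : Eu d → Eu d} {t : Eu d → ℝ} {f : ℕ → Eu d → ℝ} (h : TraceApprox Ω q v Dv t f)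
    (hv : MemLp v (ENNReal.ofReal q) (volume.restrict Ω))
    (hDv : MemLp Dv (ENNReal.ofReal q) (volume.restrict Ω))
    (ht : MemLp t (ENNReal.ofReal q) (surf Ω)) : TracedSobolev Ω q v Dv t := by
  refine ⟨⟨hv, hDv, fun φ hφ hφc hφΩ => ?_⟩, ⟨ht, f, h.smooth, h.tendsto, h.tendsto_grad,
    h.tendsto_trace⟩⟩
  have := hΩ.finite_volume
  have := holderConjugate hq
  have hq1 : 1 ≤ ENNReal.ofReal q := by simpa using hq.le
  have hbφ : MemLp φ ⊤ (volume.restrict Ω) := hΩ.memLp_interior hφ.continuous _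
  have hbg : MemLp (gradient φ) ⊤ (volume.restrict Ω) :=
    hΩ.memLp_interior (continuous_gradient hφ) _
  -- Pairing with a fixed vector `w` turns both sides into integrals of inner products, the form to
  -- which `tendsto_integral_inner` applies.
  refine ext_inner_left ℝ fun w => ?_
  have i1 : IntegrableOn (fun x => v x • gradient φ x) Ω :=
    memLp_one_iff_integrable.1 (hbg.smul (hv.mono_exponent hq1))
  have i2 : IntegrableOn (fun x => φ x • Dv x) Ω :=
    memLp_one_iff_integrable.1 ((hDv.mono_exponent hq1).smul hbφ)
  rw [inner_neg_right, ← integral_inner i1, ← integral_inner i2]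
  have l1 : Tendsto (fun n => ∫ x in Ω, ⟪⟪w, gradient φ x⟫, f n x⟫) atTop
      (𝓝 (∫ x in Ω, ⟪⟪w, gradient φ x⟫, v x⟫)) :=
    tendsto_integral_inner (p' := ENNReal.ofReal q.conjExponent) (hΩ.memLp_interior
      (continuous_const.inner (continuous_gradient hφ)) _)
      (fun n => hΩ.memLp_interior (h.smooth n).continuous _) hv h.tendsto
  have l2 : Tendsto (fun n => ∫ x in Ω, ⟪φ x • w, gradient (f n) x⟫) atTop
      (𝓝 (∫ x in Ω, ⟪φ x • w, Dv x⟫)) :=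
    tendsto_integral_inner (p' := ENNReal.ofReal q.conjExponent)
      (hΩ.memLp_interior (hφ.continuous.smul continuous_const) _)
      (fun n => hΩ.memLp_interior (continuous_gradient (h.smooth n)) _) hDv h.tendsto_grad
  have key : ∀ n, ∫ x in Ω, ⟪⟪w, gradient φ x⟫, f n x⟫ =
      - ∫ x in Ω, ⟪φ x • w, gradient (f n) x⟫ := fun n => by
    have h0 := integral_smul_gradient (h.smooth n) hφ hφc
    have z1 : ∫ x in Ω, f n x • gradient φ x = ∫ x, f n x • gradient φ x :=
      setIntegral_eq_integral_of_forall_compl_eq_zero fun x hx => by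
        rw [gradient_eq_zero_of_notMem_tsupport fun h => hx (hφΩ h), smul_zero]
    have z2 : ∫ x in Ω, φ x • gradient (f n) x = ∫ x, φ x • gradient (f n) x :=
      setIntegral_eq_integral_of_forall_compl_eq_zero fun x hx => by
        rw [image_eq_zero_of_notMem_tsupport fun h => hx (hφΩ h), zero_smul]
    have i3 : IntegrableOn (fun x => f n x • gradient φ x) Ω :=
      memLp_one_iff_integrable.1 (hΩ.memLp_interior
        ((h.smooth n).continuous.smul (continuous_gradient hφ)) 1)
    have i4 : IntegrableOn (fun x => φ x • gradient (f n) x) Ω :=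
      memLp_one_iff_integrable.1 (hΩ.memLp_interior
        (hφ.continuous.smul (continuous_gradient (h.smooth n))) 1)
    have h1 := congrArg (fun z => ⟪w, z⟫) (z1.trans (h0.trans (congrArg Neg.neg z2.symm)))
    simp only [inner_neg_right] at h1
    rw [← integral_inner i3, ← integral_inner i4] at h1
    simpa [inner_smul_left, inner_smul_right, mul_comm] using h1
  have := tendsto_nhds_unique l1 (l2.neg.congr fun n => (key n).symm)
  simpa [inner_smul_left, inner_smul_right, mul_comm] using this

end Domain

/-! ### Linear combinations, smooth multiples and arctangents of traced Sobolev functions. -/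

theorem abs_arctan_sub_arctan_le (a b : ℝ) : |Real.arctan a - Real.arctan b| ≤ |a - b| := by
  have := Convex.norm_image_sub_le_of_norm_deriv_le (f := Real.arctan) (C := 1) (s := univ)
    (x := b) (y := a) (fun x _ => Real.differentiableAt_arctan x) (fun x _ => ?_) convex_univ
    (mem_univ _) (mem_univ _)
  · simpa using this
  · rw [Real.deriv_arctan, Real.norm_of_nonneg (by positivity), div_le_one (by positivity)]
    nlinarith [sq_nonneg x]

theorem abs_arctan_le_abs (a : ℝ) : |Real.arctan a| ≤ |a| := by
  simpa using abs_arctan_sub_arctan_le a 0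

theorem norm_one_div_one_add_sq_le (a : ℝ) : ‖1 / (1 + a ^ 2)‖ ≤ 1 := by
  rw [Real.norm_of_nonneg (by positivity), div_le_one (by positivity)]
  nlinarith [sq_nonneg a]

section Operations

variable {Ω : Set (Eu d)} {q : ℝ} {v w : Eu d → ℝ} {Dv Dw : Eu d → Eu d} {t s : Eu d → ℝ}
  {f g : ℕ → Eu d → ℝ}

/-- Convergence in `L^q` gives a.e. convergence along a subsequence; one extraction serves `Ω`, a
further one serves `∂Ω`. -/
theorem TracedSobolev.exists_approx_ae (hq : 1 < q) (h : TracedSobolev Ω q v Dv t) :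
    ∃ f, TraceApprox Ω q v Dv t f ∧
      (∀ᵐ x ∂volume.restrict Ω, Tendsto (fun n => f n x) atTop (𝓝 (v x))) ∧
      ∀ᵐ x ∂surf Ω, Tendsto (fun n => f n x) atTop (𝓝 (t x)) := by
  obtain ⟨f, hf⟩ := h.exists_approx
  have hq0 : ENNReal.ofReal q ≠ 0 := by simpa using zero_lt_one.trans hq
  obtain ⟨k, hk, hkae⟩ := (tendstoInMeasure_of_tendsto_eLpNorm hq0
    (fun n => (hf.smooth n).continuous.aestronglyMeasurable) h.sobolev.memLp.1
    hf.tendsto).exists_seq_tendsto_ae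
  obtain ⟨l, hl, hlae⟩ := (tendstoInMeasure_of_tendsto_eLpNorm hq0
    (fun n => (hf.smooth (k n)).continuous.aestronglyMeasurable) h.trace.memLp.1
    (hf.comp hk.tendsto_atTop).tendsto_trace).exists_seq_tendsto_ae
  exact ⟨fun n => f (k (l n)), (hf.comp hk.tendsto_atTop).comp hl.tendsto_atTop,
    hkae.mono fun x hx => hx.comp hl.tendsto_atTop, hlae⟩

theorem tendsto_eLpNorm_linComb {X E : Type*} [MeasurableSpace X] {μ : Measure X}
    [NormedAddCommGroup E] [NormedSpace ℝ E] {p : ENNReal} (hp : 1 ≤ p) {f g : ℕ → X → E}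
    {f₀ g₀ : X → E} (a b : ℝ)
    (hf : ∀ n, AEStronglyMeasurable (fun x => f n x - f₀ x) μ)
    (hg : ∀ n, AEStronglyMeasurable (fun x => g n x - g₀ x) μ)
    (h1 : Tendsto (fun n => eLpNorm (fun x => f n x - f₀ x) p μ) atTop (𝓝 0))
    (h2 : Tendsto (fun n => eLpNorm (fun x => g n x - g₀ x) p μ) atTop (𝓝 0)) :
    Tendsto (fun n => eLpNorm (fun x => (a • f n x + b • g n x) - (a • f₀ x + b • g₀ x)) p μ)
      atTop (𝓝 0) := by
  refine (tendsto_eLpNorm_add hp (fun n => (hf n).const_smul a) (fun n => (hg n).const_smul b)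
    (tendsto_eLpNorm_of_le_mul (C := |a|) (fun n => .of_forall fun x => ?_) h1)
    (tendsto_eLpNorm_of_le_mul (C := |b|) (fun n => .of_forall fun x => ?_) h2)).congr fun n => ?_
  · simp [norm_smul]
  · simp [norm_smul]
  · congr 1; ext x
    simp only [Pi.smul_apply]; module

theorem TracedSobolev.linComb (hΩ : IsAdmissible Ω) (hq : 1 < q) (hv : TracedSobolev Ω q v Dv t)
    (hw : TracedSobolev Ω q w Dw s) (a b : ℝ) :
    TracedSobolev Ω q (fun x => a * v x + b * w x) (fun x => a • Dv x + b • Dw x)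
      (fun x => a * t x + b * s x) := by
  obtain ⟨f, hf⟩ := hv.exists_approx
  obtain ⟨g, hg⟩ := hw.exists_approx
  have hq1 : 1 ≤ ENNReal.ofReal q := by simpa using hq.le
  have hgrad : ∀ n x, gradient (fun y => a * f n y + b * g n y) x =
      a • gradient (f n) x + b • gradient (g n) x := fun n x => by
    have h1 := (hf.smooth n).differentiable (by simp) x
    have h2 := (hg.smooth n).differentiable (by simp) x
    refine ext_inner_right ℝ fun v => ?_
    simp [inner_add_left, inner_smul_left, fderiv_fun_add (h1.const_mul a) (h2.const_mul b),
      fderiv_const_mul h1, fderiv_const_mul h2]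
  refine TraceApprox.tracedSobolev (f := fun n x => a * f n x + b * g n x) hΩ hq ⟨?_, ?_, ?_, ?_⟩
    ((hv.sobolev.memLp.const_smul a).add (hw.sobolev.memLp.const_smul b))
    ((hv.sobolev.memLp_grad.const_smul a).add (hw.sobolev.memLp_grad.const_smul b))
    ((hv.trace.memLp.const_smul a).add (hw.trace.memLp.const_smul b))
  · exact fun n => (contDiff_const.mul (hf.smooth n)).add (contDiff_const.mul (hg.smooth n))
  · exact tendsto_eLpNorm_linComb hq1 a b
      (fun n => (hf.smooth n).continuous.aestronglyMeasurable.sub hv.sobolev.memLp.1)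
      (fun n => (hg.smooth n).continuous.aestronglyMeasurable.sub hw.sobolev.memLp.1)
      hf.tendsto hg.tendsto
  · simp only [hgrad]
    exact tendsto_eLpNorm_linComb hq1 a b
      (fun n => (continuous_gradient (hf.smooth n)).aestronglyMeasurable.sub
        hv.sobolev.memLp_grad.1)
      (fun n => (continuous_gradient (hg.smooth n)).aestronglyMeasurable.sub
        hw.sobolev.memLp_grad.1)
      hf.tendsto_grad hg.tendsto_grad
  · exact tendsto_eLpNorm_linComb hq1 a b
      (fun n => (hf.smooth n).continuous.aestronglyMeasurable.sub hv.trace.memLp.1)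
      (fun n => (hg.smooth n).continuous.aestronglyMeasurable.sub hw.trace.memLp.1)
      hf.tendsto_trace hg.tendsto_trace

theorem TracedSobolev.sub (hΩ : IsAdmissible Ω) (hq : 1 < q) (hv : TracedSobolev Ω q v Dv t)
    (hw : TracedSobolev Ω q w Dw s) :
    TracedSobolev Ω q (fun x => v x - w x) (fun x => Dv x - Dw x) (fun x => t x - s x) := by
  simpa [sub_eq_add_neg] using hv.linComb hΩ hq hw 1 (-1)

theorem TraceApprox.smul (hΩ : IsAdmissible Ω) (hq : 1 < q) (h : TracedSobolev Ω q v Dv t)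
    (hf : TraceApprox Ω q v Dv t f) {φ : Eu d → ℝ} (hφ : ContDiff ℝ ∞ φ) :
    TraceApprox Ω q (fun x => φ x * v x) (fun x => φ x • Dv x + v x • gradient φ x)
      (fun x => φ x * t x) (fun n x => φ x * f n x) := by
  have hq1 : 1 ≤ ENNReal.ofReal q := by simpa using hq.le
  have hgφ := continuous_gradient hφ
  obtain ⟨C, -, -, hC, hCs⟩ := hΩ.exists_bound hφ.continuous
  obtain ⟨C', -, -, hC', -⟩ := hΩ.exists_bound hgφ
  have hm := fun n => (hf.smooth n).continuous.aestronglyMeasurable.sub h.sobolev.memLp.1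
  have hm' := fun n => (continuous_gradient (hf.smooth n)).aestronglyMeasurable.sub
    h.sobolev.memLp_grad.1
  refine ⟨fun n => hφ.mul (hf.smooth n), tendsto_eLpNorm_of_le_mul (C := C) (fun n => ?_)
    hf.tendsto, ?_, tendsto_eLpNorm_of_le_mul (C := C) (fun n => ?_) hf.tendsto_trace⟩
  · filter_upwards [hC] with x hx
    rw [← mul_sub, norm_mul]; gcongr
  · refine (tendsto_eLpNorm_add hq1
      (fun n => hφ.continuous.aestronglyMeasurable.smul (hm' n))
      (fun n => (hm n).smul hgφ.aestronglyMeasurable)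
      (tendsto_eLpNorm_of_le_mul (C := C) (fun n => ?_) hf.tendsto_grad)
      (tendsto_eLpNorm_of_le_mul (C := C') (fun n => ?_) hf.tendsto)).congr fun n => ?_
    · filter_upwards [hC] with x hx
      simp only [Pi.smul_apply', Pi.sub_apply, norm_smul]; gcongr
    · filter_upwards [hC'] with x hx
      simp only [Pi.smul_apply', Pi.sub_apply, norm_smul]
      rw [mul_comm]; gcongr
    · congr 1; ext1 x
      rw [gradient_mul (hφ.differentiable (by simp) x) ((hf.smooth n).differentiable (by simp) x)]
      simp only [Pi.smul_apply', Pi.sub_apply]; module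
  · filter_upwards [hCs] with x hx
    rw [← mul_sub, norm_mul]; gcongr

theorem TracedSobolev.smul (hΩ : IsAdmissible Ω) (hq : 1 < q) (h : TracedSobolev Ω q v Dv t)
    {φ : Eu d → ℝ} (hφ : ContDiff ℝ ∞ φ) :
    TracedSobolev Ω q (fun x => φ x * v x) (fun x => φ x • Dv x + v x • gradient φ x)
      (fun x => φ x * t x) := by
  obtain ⟨f, hf⟩ := h.exists_approx
  have hbφ : MemLp φ ⊤ (volume.restrict Ω) := hΩ.memLp_interior hφ.continuous _
  have hbg : MemLp (gradient φ) ⊤ (volume.restrict Ω) :=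
    hΩ.memLp_interior (continuous_gradient hφ) _
  exact (hf.smul hΩ hq h hφ).tracedSobolev hΩ hq (h.sobolev.memLp.smul hbφ)
    ((h.sobolev.memLp_grad.smul hbφ).add (hbg.smul h.sobolev.memLp))
    (h.trace.memLp.smul (hΩ.memLp_surf hφ.continuous ⊤))

theorem TraceApprox.arctan (hq : 1 < q) (h : TracedSobolev Ω q v Dv t)
    (hf : TraceApprox Ω q v Dv t f)
    (hae : ∀ᵐ x ∂volume.restrict Ω, Tendsto (fun n => f n x) atTop (𝓝 (v x))) :
    TraceApprox Ω q (fun x => Real.arctan (v x)) (fun x => (1 / (1 + v x ^ 2)) • Dv x)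
      (fun x => Real.arctan (t x)) (fun n x => Real.arctan (f n x)) := by
  have hq1 : 1 ≤ ENNReal.ofReal q := by simpa using hq.le
  have hcont : Continuous fun a : ℝ => 1 / (1 + a ^ 2) :=
    continuous_const.div (by fun_prop) fun a => by positivity
  have hmv := hcont.comp_aestronglyMeasurable h.sobolev.memLp.1
  have hmf := fun n => (hcont.comp (hf.smooth n).continuous).aestronglyMeasurable
    (μ := volume.restrict Ω)
  have hm' := fun n => (continuous_gradient (hf.smooth n)).aestronglyMeasurable.sub
    h.sobolev.memLp_grad.1
  refine ⟨fun n => Real.contDiff_arctan.comp (hf.smooth n),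
    tendsto_eLpNorm_of_le_mul (C := 1) (fun n => .of_forall fun x => ?_) hf.tendsto, ?_,
    tendsto_eLpNorm_of_le_mul (C := 1) (fun n => .of_forall fun x => ?_) hf.tendsto_trace⟩
  · simpa using abs_arctan_sub_arctan_le (f n x) (v x)
  -- With `a(z) = 1 / (1 + z ^ 2)`, the gradient error is `a(f n) (∇(f n) - Dv) + (a(f n) - a(v))
  -- Dv`. The first term is controlled since `a ≤ 1`; the second tends to zero a.e. and is dominated
  -- by `2 ‖Dv‖`.
  · refine (tendsto_eLpNorm_add hq1 (fun n => (hmf n).smul (hm' n))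
      (fun n => ((hmf n).sub hmv).smul h.sobolev.memLp_grad.1)
      (tendsto_eLpNorm_of_le_mul (C := 1) (fun n => .of_forall fun x => ?_) hf.tendsto_grad)
      (tendsto_eLpNorm_of_dominated (b := fun x => 2 * ‖Dv x‖) (zero_lt_one.trans_le hq1).ne'
        ENNReal.ofReal_ne_top (fun n => ((hmf n).sub hmv).smul h.sobolev.memLp_grad.1)
        (h.sobolev.memLp_grad.norm.const_mul 2)
        (fun n => .of_forall fun x => ?_) ?_)).congr fun n => ?_
    · simp only [Pi.smul_apply', Pi.sub_apply, norm_smul, Function.comp]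
      gcongr; exact norm_one_div_one_add_sq_le _
    · simp only [Pi.smul_apply', Pi.sub_apply, norm_smul, Function.comp]
      gcongr
      refine (norm_sub_le _ _).trans ?_
      linarith [norm_one_div_one_add_sq_le (f n x), norm_one_div_one_add_sq_le (v x)]
    · filter_upwards [hae] with x hx
      have := ((hcont.tendsto (v x)).comp hx).sub_const (1 / (1 + v x ^ 2)) |>.smul_const (Dv x)
      simpa using this
    · congr 1; ext1 x
      rw [gradient_arctan ((hf.smooth n).differentiable (by simp) x)]
      simp only [Pi.smul_apply', Pi.sub_apply, Function.comp]; module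
  · simpa using abs_arctan_sub_arctan_le (f n x) (t x)

theorem TracedSobolev.arctan (hΩ : IsAdmissible Ω) (hq : 1 < q) (h : TracedSobolev Ω q v Dv t) :
    TracedSobolev Ω q (fun x => Real.arctan (v x)) (fun x => (1 / (1 + v x ^ 2)) • Dv x)
      (fun x => Real.arctan (t x)) := by
  obtain ⟨f, hf, hae, -⟩ := h.exists_approx_ae hq
  have hcont : Continuous fun a : ℝ => 1 / (1 + a ^ 2) :=
    continuous_const.div (by fun_prop) fun a => by positivity
  refine (hf.arctan hq h hae).tracedSobolev hΩ hq
    (h.sobolev.memLp.of_le (Real.continuous_arctan.comp_aestronglyMeasurable h.sobolev.memLp.1)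
      (.of_forall fun x => abs_arctan_le_abs _))
    (h.sobolev.memLp_grad.of_le ((hcont.comp_aestronglyMeasurable h.sobolev.memLp.1).smul
      h.sobolev.memLp_grad.1) (.of_forall fun x => ?_))
    (h.trace.memLp.of_le (Real.continuous_arctan.comp_aestronglyMeasurable h.trace.memLp.1)
      (.of_forall fun x => abs_arctan_le_abs _))
  simp only [norm_smul]
  exact mul_le_of_le_one_left (norm_nonneg _) (norm_one_div_one_add_sq_le _)

end Operations

/-! ### The flux through `Γ_D` -/

section Flux

variable {Ω ΓD ΓN : Set (Eu d)} {q : ℝ} {v w : Eu d → ℝ} {Dv Dw : Eu d → Eu d} {t s : Eu d → ℝ}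
  {j : Eu d → ℝ} {Φ : Eu d → Eu d}

theorem dirichletFlux_eq : dirichletFlux Ω ΓN j Φ v Dv t =
    (∫ x in Ω, ⟪Φ x, Dv x⟫) - ∫ x in ΓN, ⟪j x, t x⟫ ∂surf Ω := by
  simp [dirichletFlux, normalTrace, mul_comm]

theorem dirichletFlux_linComb (hq : 1 < q)
    (hΦ : MemLp Φ (ENNReal.ofReal (Real.conjExponent q)) (volume.restrict Ω))
    (hj : MemLp j (ENNReal.ofReal (Real.conjExponent q)) ((surf Ω).restrict ΓN))
    (hv : TracedSobolev Ω q v Dv t) (hw : TracedSobolev Ω q w Dw s) (a b : ℝ) :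
    dirichletFlux Ω ΓN j Φ (fun x => a * v x + b * w x) (fun x => a • Dv x + b • Dw x)
      (fun x => a * t x + b * s x) =
    a * dirichletFlux Ω ΓN j Φ v Dv t + b * dirichletFlux Ω ΓN j Φ w Dw s := by
  have := holderConjugate hq
  have i1 := integrable_inner_of_memLp hΦ hv.sobolev.memLp_grad
  have i2 := integrable_inner_of_memLp hΦ hw.sobolev.memLp_grad
  have i3 := integrable_inner_of_memLp hj (hv.trace.memLp.restrict ΓN)
  have i4 := integrable_inner_of_memLp hj (hw.trace.memLp.restrict ΓN)
  have e1 : ∫ x in Ω, ⟪Φ x, a • Dv x + b • Dw x⟫ =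
      a * (∫ x in Ω, ⟪Φ x, Dv x⟫) + b * ∫ x in Ω, ⟪Φ x, Dw x⟫ := by
    simp only [inner_add_right, inner_smul_right]
    rw [integral_add (i1.const_mul a) (i2.const_mul b), integral_const_mul, integral_const_mul]
  have e2 : ∫ x in ΓN, ⟪j x, a * t x + b * s x⟫ ∂surf Ω =
      a * (∫ x in ΓN, ⟪j x, t x⟫ ∂surf Ω) + b * ∫ x in ΓN, ⟪j x, s x⟫ ∂surf Ω := by
    rw [← integral_const_mul, ← integral_const_mul,
      ← integral_add (i3.const_mul a) (i4.const_mul b)]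
    congr 1; ext x; simp; ring
  simp only [dirichletFlux_eq, e1, e2]; ring

theorem dirichletFlux_sub (hq : 1 < q)
    (hΦ : MemLp Φ (ENNReal.ofReal (Real.conjExponent q)) (volume.restrict Ω))
    (hj : MemLp j (ENNReal.ofReal (Real.conjExponent q)) ((surf Ω).restrict ΓN))
    (hv : TracedSobolev Ω q v Dv t) (hw : TracedSobolev Ω q w Dw s) :
    dirichletFlux Ω ΓN j Φ (fun x => v x - w x) (fun x => Dv x - Dw x) (fun x => t x - s x) =
      dirichletFlux Ω ΓN j Φ v Dv t - dirichletFlux Ω ΓN j Φ w Dw s := by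
  simpa [sub_eq_add_neg] using dirichletFlux_linComb hq hΦ hj hv hw 1 (-1)

/-- The flux is two Hölder pairings, one with the gradient on `Ω` and one with the trace on `ΓN`,
hence continuous under this approximation. -/
theorem TraceApprox.tendsto_dirichletFlux (hΩ : IsAdmissible Ω) (hq : 1 < q)
    (hΦ : MemLp Φ (ENNReal.ofReal (Real.conjExponent q)) (volume.restrict Ω))
    (hj : MemLp j (ENNReal.ofReal (Real.conjExponent q)) ((surf Ω).restrict ΓN))
    (hv : TracedSobolev Ω q v Dv t) {f : ℕ → Eu d → ℝ} (hf : TraceApprox Ω q v Dv t f) :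
    Tendsto (fun n => dirichletFlux Ω ΓN j Φ (f n) (gradient (f n)) (f n)) atTop
      (𝓝 (dirichletFlux Ω ΓN j Φ v Dv t)) := by
  have := holderConjugate hq
  simp only [dirichletFlux_eq]
  refine (tendsto_integral_inner hΦ
    (fun n => hΩ.memLp_interior (continuous_gradient (hf.smooth n)) _)
    hv.sobolev.memLp_grad hf.tendsto_grad).sub
    (tendsto_integral_inner hj (fun n => (hΩ.memLp_surf (hf.smooth n).continuous _).restrict ΓN)
      (hv.trace.memLp.restrict ΓN) ?_)
  exact tendsto_of_tendsto_of_tendsto_of_le_of_le tendsto_const_nhds hf.tendsto_trace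
    (fun _ => zero_le) fun n => eLpNorm_mono_measure _ Measure.restrict_le_self

/-- The flux of `Φ` through `Γ_D` is nonpositive. -/
def IsOutgoing (Ω ΓD ΓN : Set (Eu d)) (q : ℝ) (j : Eu d → ℝ) (Φ : Eu d → Eu d) : Prop :=
  ∀ v Dv t, TracedSobolev Ω q v Dv t → (∀ᵐ x ∂(surf Ω).restrict ΓD, 0 ≤ t x) →
    dirichletFlux Ω ΓN j Φ v Dv t ≤ 0

/-- Both `M w + v` and `M w - v` have nonnegative trace on `ΓD`, so their fluxes are at most zero.
As the flux of `w` is zero, these say that the flux of `v` is both `≤ 0` and `≥ 0`. -/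
theorem IsOutgoing.dirichletFlux_eq_zero (hΩ : IsAdmissible Ω) (hq : 1 < q)
    (hΦ : MemLp Φ (ENNReal.ofReal (Real.conjExponent q)) (volume.restrict Ω))
    (hj : MemLp j (ENNReal.ofReal (Real.conjExponent q)) ((surf Ω).restrict ΓN))
    (hout : IsOutgoing Ω ΓD ΓN q j Φ) (hw : TracedSobolev Ω q w Dw s)
    (hw₀ : dirichletFlux Ω ΓN j Φ w Dw s = 0) (hv : TracedSobolev Ω q v Dv t) (M : ℝ)
    (hM : ∀ᵐ x ∂(surf Ω).restrict ΓD, |t x| ≤ M * s x) :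
    dirichletFlux Ω ΓN j Φ v Dv t = 0 := by
  have h1 := hout _ _ _ (hw.linComb hΩ hq hv M 1) (hM.mono fun x hx => by
    linarith [neg_abs_le (t x)])
  have h2 := hout _ _ _ (hw.linComb hΩ hq hv M (-1)) (hM.mono fun x hx => by
    linarith [le_abs_self (t x)])
  rw [dirichletFlux_linComb hq hΦ hj hw hv, hw₀] at h1 h2
  linarith

theorem IsOutgoing.fluxProductVanishes (hΩ : IsAdmissible Ω) (hq : 1 < q)
    (hΦ : MemLp Φ (ENNReal.ofReal (Real.conjExponent q)) (volume.restrict Ω))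
    (hj : MemLp j (ENNReal.ofReal (Real.conjExponent q)) ((surf Ω).restrict ΓN))
    (hout : IsOutgoing Ω ΓD ΓN q j Φ) (hw : TracedSobolev Ω q w Dw s)
    (hs : ∀ᵐ x ∂(surf Ω).restrict ΓD, 0 ≤ s x)
    (hw₀ : dirichletFlux Ω ΓN j Φ w Dw s = 0) : FluxProductVanishes Ω ΓN j Φ w Dw s := by
  intro φ hφ
  obtain ⟨M, -, -, -, hM⟩ := hΩ.exists_bound hφ.continuous
  refine hout.dirichletFlux_eq_zero hΩ hq hΦ hj hw hw₀ (hw.smul hΩ hq hφ) M ?_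
  filter_upwards [hs, ae_restrict_of_ae hM] with x h0 hx
  rw [abs_mul, abs_of_nonneg h0]
  exact mul_le_mul_of_nonneg_right hx h0

/-- The density `h` represents the flux only against smooth functions, and `h s` need not be locally
integrable. Since `arctan` is bounded, smooth, 1-Lipschitz and zero only at zero, `h arctan s` is
locally integrable, has the same zero set as `h s`, and is reached from the smooth functions `φ
arctan (f n)`. -/
theorem IsOutgoing.ae_mul_eq_zero (hΩ : IsAdmissible Ω) (hq : 1 < q)
    (hΓD : ∃ U, IsOpen U ∧ ΓD = U ∩ frontier Ω)
    (hΦ : MemLp Φ (ENNReal.ofReal (Real.conjExponent q)) (volume.restrict Ω))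
    (hj : MemLp j (ENNReal.ofReal (Real.conjExponent q)) ((surf Ω).restrict ΓN))
    (hout : IsOutgoing Ω ΓD ΓN q j Φ) (hw : TracedSobolev Ω q w Dw s)
    (hs : ∀ᵐ x ∂(surf Ω).restrict ΓD, 0 ≤ s x)
    (hw₀ : dirichletFlux Ω ΓN j Φ w Dw s = 0) {h : Eu d → ℝ}
    (hh : FluxIsFunction Ω ΓD ΓN j Φ h) : ∀ᵐ x ∂(surf Ω).restrict ΓD, s x * h x = 0 := by
  obtain ⟨U, hU, rfl⟩ := hΓD
  have hmeas : MeasurableSet (U ∩ frontier Ω) :=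
    hU.measurableSet.inter isClosed_frontier.measurableSet
  have hsupp : ∀ φ : Eu d → ℝ, tsupport φ ⊆ U → tsupport φ ∩ frontier Ω ⊆ U ∩ frontier Ω :=
    fun φ hφ => inter_subset_inter_left _ hφ
  obtain ⟨f, hf, haeΩ, haes⟩ := hw.exists_approx_ae hq
  have hat := hf.arctan hq hw haeΩ
  have hmat : AEStronglyMeasurable (fun x => Real.arctan (s x))
      ((surf Ω).restrict (U ∩ frontier Ω)) :=
    (Real.continuous_arctan.comp_aestronglyMeasurable hw.trace.memLp.1).restrict
  have hbd : ∀ a : ℝ, ‖Real.arctan a‖ ≤ Real.pi / 2 := fun a =>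
    abs_le.2 ⟨(Real.neg_pi_div_two_lt_arctan a).le, (Real.arctan_lt_pi_div_two a).le⟩
  -- Only products of `h` with admissible test functions are known to be integrable; a bump
  -- supported in `U` and equal to one near `x` removes the factor.
  have hloc : LocallyIntegrableOn (fun x => Real.arctan (s x) * h x) U
      ((surf Ω).restrict (U ∩ frontier Ω)) := by
    intro x hx
    obtain ⟨r, hr, hrU⟩ := Metric.isOpen_iff.1 hU x hx
    let χ : ContDiffBump x := ⟨r / 4, r / 2, by positivity, by linarith⟩
    have hχ : tsupport χ ⊆ U := by
      rw [χ.tsupport_eq]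
      exact (Metric.closedBall_subset_ball (by change r / 2 < r; linarith)).trans hrU
    have hi := (hh χ χ.contDiff χ.hasCompactSupport (hsupp _ hχ)).1
    have hi2 : Integrable (fun x => Real.arctan (s x) * (h x * χ x))
        ((surf Ω).restrict (U ∩ frontier Ω)) :=
      hi.bdd_mul hmat (.of_forall fun x => hbd _)
    refine ⟨Metric.ball x (r / 4), mem_nhdsWithin_of_mem_nhds
      (Metric.ball_mem_nhds x (by positivity)), ?_⟩
    refine hi2.integrableOn.congr_fun (fun y hy => ?_) measurableSet_ball
    have : χ y = 1 := χ.one_of_mem_closedBall (Metric.ball_subset_closedBall hy)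
    simp [this]
  -- The fundamental lemma of the calculus of variations, on the open set `U` of the ambient space
  -- with the surface measure of `ΓD`.
  have key := hU.ae_eq_zero_of_integral_contDiff_smul_eq_zero hloc ?_
  · filter_upwards [key, ae_restrict_mem hmeas] with x hx hxm
    rcases mul_eq_zero.1 (hx hxm.1) with h0 | h0
    · rw [Real.arctan_eq_zero_iff.1 h0, zero_mul]
    · rw [h0, mul_zero]
  intro φ hφ hφc hφU
  obtain ⟨M, hM₀, -, -, hM⟩ := hΩ.exists_bound hφ.continuous
  have hTS := (hw.arctan hΩ hq).smul hΩ hq hφ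
  -- The domination is `|φ arctan s| ≤ M s`, from `|arctan s| ≤ |s| = s` on `ΓD`.
  have hzero := hout.dirichletFlux_eq_zero hΩ hq hΦ hj hw hw₀ hTS M (by
    filter_upwards [hs, ae_restrict_of_ae hM] with x h0 hx
    rw [abs_mul]
    exact mul_le_mul hx ((abs_arctan_le_abs _).trans_eq (abs_of_nonneg h0)) (abs_nonneg _) hM₀)
  have hlim := (hat.smul hΩ hq (hw.arctan hΩ hq) hφ).tendsto_dirichletFlux hΩ hq hΦ hj hTS
  rw [hzero] at hlim
  have hi := (hh φ hφ hφc (hsupp _ hφU)).1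
  -- The second limit of the same sequence: dominated convergence on the boundary, with `(π / 2) |h
  -- φ|` as majorant.
  have hlim2 : Tendsto (fun n => ∫ x in U ∩ frontier Ω, h x * (φ x * Real.arctan (f n x)) ∂surf Ω)
      atTop (𝓝 (∫ x in U ∩ frontier Ω, h x * (φ x * Real.arctan (s x)) ∂surf Ω)) := by
    refine tendsto_integral_of_dominated_convergence
      (fun x => ‖h x * φ x‖ * (Real.pi / 2)) (fun n => ?_) (hi.norm.mul_const _)
      (fun n => .of_forall fun x => ?_) ?_
    · simp only [← mul_assoc]
      exact hi.aestronglyMeasurable.mul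
        (Real.continuous_arctan.comp (hf.smooth n).continuous).aestronglyMeasurable
    · rw [← mul_assoc, norm_mul]
      gcongr; exact hbd _
    · filter_upwards [ae_restrict_of_ae haes] with x hx
      exact ((Real.continuous_arctan.continuousAt.tendsto.comp hx).const_mul _).const_mul _
  have heq : ∀ n, dirichletFlux Ω ΓN j Φ (fun x => φ x * Real.arctan (f n x))
      (gradient fun x => φ x * Real.arctan (f n x)) (fun x => φ x * Real.arctan (f n x)) =
      ∫ x in U ∩ frontier Ω, h x * (φ x * Real.arctan (f n x)) ∂surf Ω := fun n =>
    (hh _ (hφ.mul (hat.smooth n)) hφc.mul_right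
      (hsupp _ ((tsupport_mul_subset_left).trans hφU))).2
  have := tendsto_nhds_unique (hlim.congr heq) hlim2
  rw [this]
  congr 1; ext x; simp; ring

end Flux

/-! ### Convexity -/

theorem sub_le_inner_gradient {F : Eu d → ℝ} (hF : ConvexOn ℝ univ F) {p : Eu d}
    (hd : DifferentiableAt ℝ F p) (r : Eu d) : F p - F r ≤ ⟪gradient F p, p - r⟫ := by
  have hline : ConvexOn ℝ univ (F ∘ AffineMap.lineMap (k := ℝ) p r) := by
    simpa using hF.comp_affineMap (AffineMap.lineMap (k := ℝ) p r)
  have hder : HasDerivAt (F ∘ AffineMap.lineMap (k := ℝ) p r) (fderiv ℝ F p (r - p)) 0 := by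
    have h0 : HasFDerivAt F (fderiv ℝ F p) (AffineMap.lineMap (k := ℝ) p r 0) := by
      simpa using hd.hasFDerivAt
    exact h0.comp_hasDerivAt 0 AffineMap.hasDerivAt_lineMap
  have := hline.le_slope_of_hasDerivAt (mem_univ 0) (mem_univ 1) zero_lt_one hder
  have e : fderiv ℝ F p (r - p) = -⟪gradient F p, p - r⟫ := by
    rw [← inner_neg_right, neg_sub, inner_gradient_left]
  rw [e] at this
  simp [slope_def_field] at this
  simpa using (by linarith : F p - F r ≤ fderiv ℝ F p p - fderiv ℝ F p r)

/-- Apply the gradient inequality between `p` and the midpoint of `p` and `r`; strict convexity at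
the midpoint makes the result strict. -/
theorem sub_lt_inner_gradient {F : Eu d → ℝ} (hF : StrictConvexOn ℝ univ F)
    {p : Eu d} (hd : DifferentiableAt ℝ F p) {r : Eu d} (hpr : p ≠ r) :
    F p - F r < ⟪gradient F p, p - r⟫ := by
  have h1 := sub_le_inner_gradient hF.convexOn hd ((1 / 2 : ℝ) • p + (1 / 2 : ℝ) • r)
  have h2 := hF.2 (mem_univ p) (mem_univ r) hpr (half_pos one_pos) (half_pos one_pos)
    (add_halves (1 : ℝ))
  have e : p - ((1 / 2 : ℝ) • p + (1 / 2 : ℝ) • r) = (1 / 2 : ℝ) • (p - r) := by module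
  rw [e, inner_smul_right] at h1
  simp only [smul_eq_mul] at h2
  linarith

/-- `G'` is nondecreasing by convexity and `G' (g μ) = μ`, so `g b ≤ g a` would force `b ≤ a`. -/
theorem IsPseudoInverse.lt {g G : ℝ → ℝ} {α : ℝ} (hg : IsPseudoInverse g G) (hG : IsPotential G α)
    {a b : ℝ} (ha : 0 ≤ a) (hab : a < b) : g a < g b := by
  by_contra! hle
  have hmono : MonotoneOn (deriv G) univ :=
    hG.convex.monotoneOn_deriv fun x _ => hG.c1.differentiable one_ne_zero x
  have := hmono (mem_univ _) (mem_univ _) hle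
  rw [(hg a ha).1, (hg b (ha.trans hab.le)).1] at this
  exact absurd hab (not_lt.2 this)

/-- The pointwise monotonicity of the system. -/
theorem monotonicity {F : Eu d → ℝ} (hF : StrictConvexOn ℝ univ F) (hd : Differentiable ℝ F)
    {g : ℝ → ℝ} (hg : ∀ a b, 0 ≤ a → a < b → g a < g b) {m η : ℝ} (hm : 0 ≤ m) (hη : 0 ≤ η)
    {p r : Eu d} (hp : 0 < m → F p = g m) (hp' : F p ≤ g m) (hr : 0 < η → F r = g η)
    (hr' : F r ≤ g η) :
    0 ≤ ⟪m • gradient F p, p - r⟫ + ⟪η • gradient F r, r - p⟫ ∧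
      (⟪m • gradient F p, p - r⟫ + ⟪η • gradient F r, r - p⟫ = 0 → η = m ∧ (0 < m → p = r)) := by
  -- Weighted by `m` and `η`, the two gradient inequalities bound the sum below by `(m - η) (F p - F
  -- r)`. If `m < η`, then `η > 0` and `F r = g η > g m ≥ F p`, so this is positive, and
  -- symmetrically if `η < m`. If `m = η` the bound is zero, and strict convexity settles the
  -- equality case.
  have hA := sub_le_inner_gradient hF.convexOn (hd p) r
  have hB := sub_le_inner_gradient hF.convexOn (hd r) p
  simp only [real_inner_smul_left]
  have hA' := mul_le_mul_of_nonneg_left hA hm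
  have hB' := mul_le_mul_of_nonneg_left hB hη
  rcases lt_trichotomy m η with h | rfl | h
  · have := hg m η hm h
    rw [← hr (hm.trans_lt h)] at this
    have : 0 < (η - m) * (F r - F p) := mul_pos (sub_pos.2 h) (by linarith)
    exact ⟨by linarith, fun h0 => by linarith⟩
  · refine ⟨by linarith, fun h0 => ⟨rfl, fun hpos => by_contra fun hpr => ?_⟩⟩
    have := mul_lt_mul_of_pos_left (sub_lt_inner_gradient hF (hd p) hpr) hpos
    linarith
  · have := hg η m hη h
    rw [← hp (hη.trans_lt h)] at this
    have : 0 < (m - η) * (F p - F r) := mul_pos (sub_pos.2 h) (by linarith)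
    exact ⟨by linarith, fun h0 => by linarith⟩

/-! ### Regularity of the Hamiltonian, integrability of the flow and of the inflow. -/

theorem IsHamiltonian.differentiable {Ω : Set (Eu d)} (hΩ : IsOpen Ω) {H : Eu d → Eu d → ℝ}
    {β : ℝ} (hH : IsHamiltonian Ω H β) {x : Eu d} (hx : x ∈ Ω) : Differentiable ℝ (H x) := by
  intro p
  have hmem : closure Ω ×ˢ (univ : Set (Eu d)) ∈ 𝓝 (x, p) :=
    prod_mem_nhds (mem_of_superset (hΩ.mem_nhds hx) subset_closure) univ_mem
  have h1 := (hH.c2.contDiffAt hmem).differentiableAt two_ne_zero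
  exact DifferentiableAt.comp (g := fun z : Eu d × Eu d => H z.1 z.2) p h1
    ((differentiableAt_const x).prodMk differentiableAt_id)

/-- By the growth of `D_pH`, the flow is bounded by a multiple of `m (‖Du‖^(β-1) + 1)`, with `m ∈
L^{α'}` and `‖Du‖^(β-1) ∈ L^{γ/(β-1)}`. Hölder applies because `1/α' + (β-1)/(αβ) = 1 - 1/(αβ) =
1/γ'`. -/
theorem memLp_flow {Ω : Set (Eu d)} (hΩ : IsAdmissible Ω) {H : Eu d → Eu d → ℝ} {α β : ℝ}
    (hα : 1 < α) (hH : IsHamiltonian Ω H β) {m : Eu d → ℝ} {Du : Eu d → Eu d}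
    (hm : MemLp m (ENNReal.ofReal (Real.conjExponent α)) (volume.restrict Ω))
    (hDu : MemLp Du (ENNReal.ofReal (α * β)) (volume.restrict Ω))
    (hflow : IntegrableOn (flow H m Du) Ω) :
    MemLp (flow H m Du) (ENNReal.ofReal (Real.conjExponent (α * β))) (volume.restrict Ω) := by
  have := hΩ.finite_volume
  have hβ := hH.one_lt
  have hβ' : 0 < β - 1 := sub_pos.2 hβ
  have hαβ : 1 < α * β := one_lt_mul_of_lt_of_le hα hβ.le
  have hpow := hDu.norm_rpow_div (ENNReal.ofReal (β - 1))
  rw [ENNReal.toReal_ofReal hβ'.le, ← ENNReal.ofReal_div_of_pos hβ'] at hpow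
  have htriple : ENNReal.HolderTriple (ENNReal.ofReal (Real.conjExponent α))
      (ENNReal.ofReal (α * β / (β - 1))) (ENNReal.ofReal (Real.conjExponent (α * β))) := by
    have h1 : α - 1 ≠ 0 := (sub_pos.2 hα).ne'
    have h2 : α * β - 1 ≠ 0 := (sub_pos.2 hαβ).ne'
    refine Real.HolderTriple.ennrealOfReal ⟨?_, ?_, ?_⟩
    · simp only [Real.conjExponent]
      field_simp
      ring
    · exact div_pos (by linarith) (sub_pos.2 hα)
    · exact div_pos (by linarith) hβ'
  obtain ⟨C, hC, hgrowth⟩ := hH.growth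
  refine ((hpow.add (memLp_const (1 : ℝ))).mul' hm).of_le_mul (c := C)
    hflow.aestronglyMeasurable ?_
  filter_upwards [ae_restrict_mem hΩ.isOpen.measurableSet] with x hx
  have h3 := (hgrowth x hx (Du x)).2.2.2
  have h4 : 0 ≤ ‖Du x‖ ^ (β - 1) + 1 := by positivity
  rw [flow, norm_smul, norm_mul, Pi.add_apply, Real.norm_of_nonneg h4]
  calc _ ≤ ‖m x‖ * (C * (‖Du x‖ ^ (β - 1) + 1)) := by gcongr
    _ = _ := by ring

/-- Since `β ≤ αβ`, the conjugate exponents satisfy `γ' ≤ β'`, and the surface measure is finite. -/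
theorem IsInflow.memLp_mul {Ω ΓN : Set (Eu d)} (hΩ : IsAdmissible Ω) {j : Eu d → ℝ} {α β : ℝ}
    (hj : IsInflow Ω ΓN j β) (hα : 1 < α) (hβ : 1 < β) :
    MemLp j (ENNReal.ofReal (Real.conjExponent (α * β))) ((surf Ω).restrict ΓN) := by
  have := hΩ.finite_surf
  have hαβ : β ≤ α * β := le_mul_of_one_le_left (by linarith) hα.le
  refine hj.memLp.mono_exponent (ENNReal.ofReal_le_ofReal ?_)
  rw [Real.conjExponent, Real.conjExponent, div_le_div_iff₀ (by linarith) (by linarith)]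
  linarith

/-! ### Weak solutions -/

section Solution

variable {Ω ΓD ΓN : Set (Eu d)} {α β : ℝ} {H : Eu d → Eu d → ℝ} {g : ℝ → ℝ} {j ψ : Eu d → ℝ}
  {Dψ : Eu d → Eu d} {tψ m u : Eu d → ℝ} {Du : Eu d → Eu d} {tu : Eu d → ℝ}

theorem IsWeakSolution.isOutgoing
    (hu : IsWeakSolution Ω ΓD ΓN α β H g j ψ Dψ tψ m u Du tu) :
    IsOutgoing Ω ΓD ΓN (α * β) j (flow H m Du) :=
  fun v Dv t hv ht => hu.exit v Dv t hv.sobolev hv.trace ht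

theorem IsWeakSolution.tracedSobolev
    (hu : IsWeakSolution Ω ΓD ΓN α β H g j ψ Dψ tψ m u Du tu) :
    TracedSobolev Ω (α * β) u Du tu :=
  ⟨hu.sobolev_u, hu.trace_u⟩

/-- The contact condition with `φ = 1`. -/
theorem IsWeakSolution.dirichletFlux_eq_zero
    (hu : IsWeakSolution Ω ΓD ΓN α β H g j ψ Dψ tψ m u Du tu) :
    dirichletFlux Ω ΓN j (flow H m Du) (fun x => ψ x - u x) (fun x => Dψ x - Du x)
      (fun x => tψ x - tu x) = 0 := by
  simpa [gradient_fun_const] using hu.contact (fun _ => 1) contDiff_const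

end Solution

end MixedMFG

end

/-! ### The uniqueness theorem. -/

open MixedMFG
theorem theorem2 {d : ℕ} (hd : 1 ≤ d) {Ω ΓD ΓN : Set (Eu d)}
    (hΩ : IsC1Domain Ω) (hΓ : IsBoundaryPartition Ω ΓD ΓN)
    {α β : ℝ} {G g : ℝ → ℝ} (hG : IsPotential G α) (hg : IsPseudoInverse g G)
    {H : Eu d → Eu d → ℝ} (hH : IsHamiltonian Ω H β)
    {j : Eu d → ℝ} (hj : IsInflow Ω ΓN j β)
    {ψ : Eu d → ℝ} {Dψ : Eu d → Eu d} {tψ : Eu d → ℝ}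
    (hψ : MemSobolev Ω (α * β) ψ Dψ) (htψ : HasTrace Ω (α * β) ψ Dψ tψ)
    {m u : Eu d → ℝ} {Du : Eu d → Eu d} {tu : Eu d → ℝ}
    (hu : IsWeakSolution Ω ΓD ΓN α β H g j ψ Dψ tψ m u Du tu)
    {η ξ : Eu d → ℝ} {Dξ : Eu d → Eu d} {tξ : Eu d → ℝ}
    (hξ : IsWeakSolution Ω ΓD ΓN α β H g j ψ Dψ tψ η ξ Dξ tξ) :
    -- (1) the cross contact-set conditions on `Γ_D`, in the sense of normal traces,
    (FluxProductVanishes Ω ΓN j (flow H η Dξ)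
        (fun x => ψ x - u x) (fun x => Dψ x - Du x) (fun x => tψ x - tu x) ∧
      FluxProductVanishes Ω ΓN j (flow H m Du)
        (fun x => ψ x - ξ x) (fun x => Dψ x - Dξ x) (fun x => tψ x - tξ x)) ∧
    -- and pointwise almost everywhere where the normal traces are functions,
    ((∀ h : Eu d → ℝ, FluxIsFunction Ω ΓD ΓN j (flow H η Dξ) h →
        ∀ᵐ x ∂(surf Ω).restrict ΓD, (tψ x - tu x) * h x = 0) ∧
      (∀ h : Eu d → ℝ, FluxIsFunction Ω ΓD ΓN j (flow H m Du) h →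
        ∀ᵐ x ∂(surf Ω).restrict ΓD, (tψ x - tξ x) * h x = 0)) ∧
    -- (2) `η = m` almost everywhere in `Ω`,
    (∀ᵐ x ∂volume.restrict Ω, η x = m x) ∧
    -- (3) `Du = Dξ` almost everywhere in `{m > 0}`.
    (∀ᵐ x ∂volume.restrict Ω, 0 < m x → Du x = Dξ x) := by
  have hA := IsC1Domain.isAdmissible hd hΩ
  have hα := hG.one_lt
  have hβ := hH.one_lt
  have hq : 1 < α * β := one_lt_mul_of_lt_of_le hα hβ.le
  have hjq := hj.memLp_mul hA hα hβ
  have hΦ := memLp_flow hA hα hH hu.memLp_m hu.sobolev_u.memLp_grad hu.flow_integrable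
  have hΨ := memLp_flow hA hα hH hξ.memLp_m hξ.sobolev_u.memLp_grad hξ.flow_integrable
  have tψ' : TracedSobolev Ω (α * β) ψ Dψ tψ := ⟨hψ, htψ⟩
  have twu := tψ'.sub hA hq hu.tracedSobolev
  have twξ := tψ'.sub hA hq hξ.tracedSobolev
  have su : ∀ᵐ x ∂(surf Ω).restrict ΓD, 0 ≤ tψ x - tu x :=
    hu.le_exit_cost.mono fun x hx => sub_nonneg.2 hx
  have sξ : ∀ᵐ x ∂(surf Ω).restrict ΓD, 0 ≤ tψ x - tξ x :=
    hξ.le_exit_cost.mono fun x hx => sub_nonneg.2 hx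
  have := holderConjugate hq
  have i1 := integrable_inner_of_memLp hΦ (hu.sobolev_u.memLp_grad.sub hξ.sobolev_u.memLp_grad)
  have i2 := integrable_inner_of_memLp hΨ (hξ.sobolev_u.memLp_grad.sub hu.sobolev_u.memLp_grad)
  have hmono : ∀ᵐ x ∂volume.restrict Ω,
      0 ≤ ⟪flow H m Du x, (Du - Dξ) x⟫ + ⟪flow H η Dξ x, (Dξ - Du) x⟫ ∧
      (⟪flow H m Du x, (Du - Dξ) x⟫ + ⟪flow H η Dξ x, (Dξ - Du) x⟫ = 0 →
        η x = m x ∧ (0 < m x → Du x = Dξ x)) := by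
    filter_upwards [ae_restrict_mem hΩ.isOpen.measurableSet, hu.nonneg, hξ.nonneg, hu.hj_eq,
      hu.hj_le, hξ.hj_eq, hξ.hj_le] with x hx h1 h2 h3 h4 h5 h6
    exact monotonicity (hH.convex x hx) (hH.differentiable hΩ.isOpen hx)
      (fun a b => hg.lt hG) h1 h2 h3 h4 h5 h6
  have hnonneg := integral_nonneg_of_ae (hmono.mono fun x hx => hx.1)
  have hout1 := hu.isOutgoing _ _ _ twξ sξ
  have hout2 := hξ.isOutgoing _ _ _ twu su
  have z1 := hu.dirichletFlux_eq_zero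
  have z2 := hξ.dirichletFlux_eq_zero
  have c1 := dirichletFlux_sub hq hΦ hjq hu.tracedSobolev hξ.tracedSobolev
  have c2 := dirichletFlux_sub hq hΨ hjq hξ.tracedSobolev hu.tracedSobolev
  have d1 := dirichletFlux_sub hq hΦ hjq tψ' hu.tracedSobolev
  have d2 := dirichletFlux_sub hq hΦ hjq tψ' hξ.tracedSobolev
  have d3 := dirichletFlux_sub hq hΨ hjq tψ' hu.tracedSobolev
  have d4 := dirichletFlux_sub hq hΨ hjq tψ' hξ.tracedSobolev
  -- Both flows carry the same `j` on `ΓN`, so the Neumann terms in `c1` and `c2` are opposite.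
  have hcancel : ∫ x in ΓN, ⟪j x, tξ x - tu x⟫ ∂surf Ω =
      -∫ x in ΓN, ⟪j x, tu x - tξ x⟫ ∂surf Ω := by
    rw [← integral_neg]
    congr 1; ext x
    rw [← inner_neg_right, neg_sub]
  rw [dirichletFlux_eq (v := fun x => u x - ξ x)] at c1
  rw [dirichletFlux_eq (v := fun x => ξ x - u x), hcancel] at c2
  have hsum := integral_add i1 i2
  simp only [Pi.sub_apply] at hsum hnonneg hmono
  -- The nonnegative integral equals the sum of the two cross fluxes, each at most zero; hence all
  -- three vanish.
  have w1 : dirichletFlux Ω ΓN j (flow H m Du) (fun x => ψ x - ξ x) (fun x => Dψ x - Dξ x)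
      (fun x => tψ x - tξ x) = 0 := by linarith
  have w2 : dirichletFlux Ω ΓN j (flow H η Dξ) (fun x => ψ x - u x) (fun x => Dψ x - Du x)
      (fun x => tψ x - tu x) = 0 := by linarith
  have hint : ∫ x in Ω, (⟪flow H m Du x, Du x - Dξ x⟫ + ⟪flow H η Dξ x, Dξ x - Du x⟫) = 0 := by
    linarith
  have hzero := (integral_eq_zero_iff_of_nonneg_ae (hmono.mono fun x hx => hx.1)
    (i1.add i2)).1 hint
  have hconc : ∀ᵐ x ∂volume.restrict Ω, η x = m x ∧ (0 < m x → Du x = Dξ x) := by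
    filter_upwards [hmono, hzero] with x hx h0 using hx.2 h0
  exact ⟨⟨hξ.isOutgoing.fluxProductVanishes hA hq hΨ hjq twu su w2,
      hu.isOutgoing.fluxProductVanishes hA hq hΦ hjq twξ sξ w1⟩,
    ⟨fun h hh => hξ.isOutgoing.ae_mul_eq_zero hA hq hΓ.open_D hΨ hjq twu su w2 hh,
      fun h hh => hu.isOutgoing.ae_mul_eq_zero hA hq hΓ.open_D hΦ hjq twξ sξ w1 hh⟩,
    hconc.mono fun x hx => hx.1, hconc.mono fun x hx => hx.2⟩
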